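/- Let $\mathcal L=\mathbb Z[s^{\pm1},t^{\pm1},q^{\pm1}]$. Let $K$ be an oriented virtual knot or link, represented by any oriented virtual link diagram $D$: finitely many oriented circles immersed in the plane whose only multiple points are transverse double points (crossings), each marked as classical positive, classical negative, or virtual. A short arc of $D$ runs from one crossing (classical or virtual) to the next; a component without crossings counts as one short arc. Let $a_1,\dots,a_n$ be the short arcs. The virtual knot group $\mathit{VG}_K$ has generators $a_1,\dots,a_n,s,q$, the relation $[s,q]=1$, and two relations for each crossing, as follows. Turn the page so that both strands at the crossing point upwards; let $x_l,x_r$ be the incoming arcs at the bottom left and bottom right, and $x'_l,x'_r$ the outgoing arcs at the top left and top right (the strands are $x_l\to x'_r$ and $x_r\to x'_l$). - Positive crossing (over-strand $x_l\to x'_r$): $x'_r=s\,x_l\,s^{-1}$ and $x'_l=x_l\,x_r\,(s\,x_l^{-1}s^{-1})$. - Negative crossing (over-strand $x_r\to x'_l$): $x'_l=s^{-1}x_r\,s$ and $x'_r=(s^{-1}x_r^{-1}s)\,x_l\,x_r$. - Virtual crossing: $x'_r=q\,x_l\,q^{-1}$ and $x'_l=q^{-1}x_r\,q$. Let $M$ be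 the matrix over $\mathcal L$ of the Fox derivatives of all relators with respect to all $n+2$ generators, evaluated at $a_1=\dots=a_n=t$, $s=s$, $q=q$. Let $\mathcal E_0\subseteq\mathcal L$ be the ideal generated by the $(n+1)\times(n+1)$ minors of $M$ ($\mathcal E_0=0$ if there are none). The virtual Alexander polynomial $H_K(s,t,q)\in\mathcal L$ is a generator of the smallest principal ideal containing $\mathcal E_0$, that is, the greatest common divisor of these minors; it is defined up to units of $\mathcal L$, i.e. up to factors $\pm s^it^jq^k$. Theorem. For every virtual knot or link $K$ (and every diagram $D$ representing it), the smallest principal ideal containing $\mathcal E_0$ exists, and its generator satisfies $$H_K(s,t,q)=H_K(sq^{-1},tq,1)$$ up to multiplication by a unit of $\mathcal L$. -/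

import Mathlib

namespace VirtualLink

noncomputable section

/-! ### Oriented virtual link diagrams

Near each crossing turn the page so that both strands point upwards.  The four ends at the
crossing are then the incoming ends at the bottom left and bottom right and the outgoing ends at
the top left and top right; one strand runs from bottom left to top right, the other one from
bottom right to top left. -/

/-- The left or the right side of a crossing whose two strands point upwards. -/
inductive Side
  | left
  | right
  deriving DecidableEq

instance : Fintype Side := ⟨{Side.left, Side.right}, fun a => by cases a <;> decide⟩

/-- A crossing is classical and positive (the strand from bottom left to top right is the
over-strand), classical and negative (the strand from bottom right to top left is the over-strand),
or virtual. -/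
inductive CrossingType
  | positive
  | negative
  | virtual
  deriving DecidableEq

/-- The combinatorial data of an oriented link diagram on a closed oriented surface: crossings with
their types, the way in which the outgoing ends of the crossings are joined to the incoming ends,
and a number of circles without crossings. -/
structure DiagramData where
  /-- the number of crossings, classical and virtual -/
  numCrossings : ℕ
  /-- the type of each crossing -/
  type : Fin numCrossings → CrossingType
  /-- `next (c, a) = (d, b)` if the arc that leaves `c` at the top on side `a` arrives at the bottom
  of `d` on side `b` -/
  next : Equiv.Perm (Fin numCrossings × Side)
  /-- the number of components without crossings -/
  numCircles : ℕ

namespace DiagramData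

variable (D : DiagramData)

/-- The short arcs of the diagram: each arc between two crossings is named after the outgoing end
at which it starts; each circle without crossings is one further arc. -/
abbrev Arc : Type := (Fin D.numCrossings × Side) ⊕ Fin D.numCircles

/-- The arc that leaves the crossing `c` at the top on side `a`. -/
def outArc (c : Fin D.numCrossings) (a : Side) : D.Arc := Sum.inl (c, a)

/-- The arc that arrives at the crossing `c` at the bottom on side `a`. -/
def inArc (c : Fin D.numCrossings) (a : Side) : D.Arc := Sum.inl (D.next.symm (c, a))

/-- An arc between crossings, together with a direction in which it is traversed: `true` for the
direction of its orientation, `false` for the opposite one. -/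
abbrev Dart : Type := (Fin D.numCrossings × Side) × Bool

/-- Walk along an arc up to the crossing at its end and continue there with the neighbouring end,
in such a way that one walks along the boundary of the region on the left-hand side.
The ends of a crossing, in clockwise order, are
bottom left, top left, top right, bottom right, and one leaves at the end that follows the one at
which one arrives. -/
def turn : D.Dart → D.Dart
  | (e, true) =>
    match D.next e with
    | (c, Side.left) => ((c, Side.left), true)
    | (c, Side.right) => (D.next.symm (c, Side.left), false)
  | ((c, Side.left), false) => ((c, Side.right), true)
  | ((c, Side.right), false) => (D.next.symm (c, Side.right), false)

/-- The boundary cycles of the regions of the diagram: orbits of darts under `turn`. -/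
abbrev Face : Type := Quot fun x y : D.Dart => D.turn x = y

/-- The connected components of the underlying four-valent graph (circles without crossings are
not counted). -/
abbrev Component : Type :=
  Quot fun c d : Fin D.numCrossings => ∃ a b : Side, D.next (c, a) = (d, b)

/-- The diagram lies in the plane (equivalently, in the sphere): each component of its underlying
four-valent graph, with the given cyclic order of the ends at each crossing, has genus `0`.
By Euler's formula, `V - E + F` is at most `2` for each component, with equality if and only if its
genus is `0`, and here `E = 2 V`.  All crossings, also the virtual ones, are vertices. -/
def IsPlanar : Prop :=
  (D.numCrossings : ℤ) - 2 * D.numCrossings + Nat.card D.Face = 2 * Nat.card D.Component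

end DiagramData

/-- An oriented virtual link diagram: finitely many oriented circles immersed in the plane whose
only multiple points are transverse double points, each marked as a positive, negative or virtual
crossing. -/
structure Diagram extends DiagramData where
  planar : toDiagramData.IsPlanar

/-! ### The virtual knot group -/

namespace DiagramData

variable (D : DiagramData)

/-- The generators of the virtual knot group: the short arcs and the auxiliary generators `s` and
`q`. -/
inductive Generator
  | arc (a : D.Arc)
  | s
  | q
  deriving DecidableEq, Fintype

/-- The relations of the virtual knot group: two for each crossing (one for each of the outgoing
arcs), and the commutation relation for `s` and `q`. -/
inductive Relation
  | crossing (c : Fin D.numCrossings) (a : Side)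
  | comm
  deriving DecidableEq, Fintype

/-- The free group on the generators of the virtual knot group. -/
abbrev Free : Type := FreeGroup D.Generator

/-- The generator `s` in the free group. -/
def fs : D.Free := FreeGroup.of Generator.s

/-- The generator `q` in the free group. -/
def fq : D.Free := FreeGroup.of Generator.q

/-- The generator of the arc that arrives at `c` on side `a`. -/
def fin (c : Fin D.numCrossings) (a : Side) : D.Free := FreeGroup.of (Generator.arc (D.inArc c a))

/-- The generator of the arc that leaves `c` on side `a`. -/
def fout (c : Fin D.numCrossings) (a : Side) : D.Free := FreeGroup.of (Generator.arc (D.outArc c a))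

/-- The value that the relations at a crossing prescribe for its outgoing arcs.  With `x` the
incoming arc of the over-strand and `y` that of the under-strand, the over-strand continues as
`s x s⁻¹` and the under-strand as `x y (s x⁻¹ s⁻¹)` at a positive crossing; they continue as
`s⁻¹ x s` and `(s⁻¹ x⁻¹ s) y x` at a negative crossing.  At a virtual crossing the strand from left
to right is conjugated by `q` and the strand from right to left by `q⁻¹`. -/
def outWord (c : Fin D.numCrossings) (a : Side) : D.Free :=
  let l := D.fin c Side.left
  let r := D.fin c Side.right
  match D.type c, a with
  | CrossingType.positive, Side.right => D.fs * l * D.fs⁻¹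
  | CrossingType.positive, Side.left => l * r * (D.fs * l⁻¹ * D.fs⁻¹)
  | CrossingType.negative, Side.left => D.fs⁻¹ * r * D.fs
  | CrossingType.negative, Side.right => (D.fs⁻¹ * r⁻¹ * D.fs) * l * r
  | CrossingType.virtual, Side.right => D.fq * l * D.fq⁻¹
  | CrossingType.virtual, Side.left => D.fq⁻¹ * r * D.fq

/-- The relators of the virtual knot group. -/
def relator : D.Relation → D.Free
  | Relation.crossing c a => D.fout c a * (D.outWord c a)⁻¹
  | Relation.comm => D.fs * D.fq * D.fs⁻¹ * D.fq⁻¹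

/-- The virtual knot group of a diagram. -/
abbrev VirtualKnotGroup : Type := PresentedGroup (Set.range D.relator)

end DiagramData

/-! ### Fox derivatives -/

section Fox

variable {X : Type*} [DecidableEq X]

/-- The Fox derivative with respect to `x` of a word in the letters `y` (written `(y, true)`) and
`y⁻¹` (written `(y, false)`), in the integral group ring of the free group: it is determined by
`∂y/∂x = δ`, `∂(y⁻¹)/∂x = - y⁻¹ δ` and `∂(u v)/∂x = ∂u/∂x + u ∂v/∂x`. -/
def foxWord (x : X) : List (X × Bool) → MonoidAlgebra ℤ (FreeGroup X)
  | [] => 0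
  | (y, true) :: w =>
    (if y = x then 1 else 0) + MonoidAlgebra.of ℤ _ (FreeGroup.of y) * foxWord x w
  | (y, false) :: w =>
    MonoidAlgebra.of ℤ _ (FreeGroup.of y)⁻¹ * (foxWord x w - if y = x then 1 else 0)

theorem foxWord_cancel (x y : X) (b : Bool) (w : List (X × Bool)) :
    foxWord x ((y, b) :: (y, !b) :: w) = foxWord x w := by
  have h1 : MonoidAlgebra.of ℤ (FreeGroup X) (FreeGroup.of y) *
      MonoidAlgebra.of ℤ (FreeGroup X) (FreeGroup.of y)⁻¹ = 1 := by
    rw [← map_mul, mul_inv_cancel, map_one]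
  have h2 : MonoidAlgebra.of ℤ (FreeGroup X) (FreeGroup.of y)⁻¹ *
      MonoidAlgebra.of ℤ (FreeGroup X) (FreeGroup.of y) = 1 := by
    rw [← map_mul, inv_mul_cancel, map_one]
  cases b
  · simp only [foxWord, Bool.not_false]
    rw [add_sub_cancel_left, ← mul_assoc, h2, one_mul]
  · simp only [foxWord, Bool.not_true]
    rw [← mul_assoc, h1, one_mul, add_sub_cancel]

theorem foxWord_step (x : X) {w w' : List (X × Bool)} (h : FreeGroup.Red.Step w w') :
    foxWord x w = foxWord x w' := by
  obtain @⟨u, v, y, b⟩ := h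
  induction u with
  | nil => exact foxWord_cancel x y b v
  | cons z u ih => obtain ⟨z, _ | _⟩ := z <;> simp only [List.cons_append, foxWord, ih]

/-- The Fox derivative `∂/∂x` on the free group, with values in its integral group ring. -/
def fox (x : X) : FreeGroup X → MonoidAlgebra ℤ (FreeGroup X) :=
  Quot.lift (foxWord x) fun _ _ h => foxWord_step x h

end Fox

/-! ### Laurent polynomials in `s`, `t`, `q` -/

/-- The ring `ℤ[s^{±1}, t^{±1}, q^{±1}]`, as the group ring of `ℤ³`. -/
abbrev Laurent : Type := AddMonoidAlgebra ℤ (Fin 3 → ℤ)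

/-- The monomial `s^i t^j q^k` with `v = (i, j, k)`, as a unit. -/
def monomial : Multiplicative (Fin 3 → ℤ) →* Laurentˣ :=
  (AddMonoidAlgebra.of ℤ (Fin 3 → ℤ)).toHomUnits

/-- The variable `s`. -/
def s : Laurentˣ := monomial (Multiplicative.ofAdd ![1, 0, 0])

/-- The variable `t`. -/
def t : Laurentˣ := monomial (Multiplicative.ofAdd ![0, 1, 0])

/-- The variable `q`. -/
def q : Laurentˣ := monomial (Multiplicative.ofAdd ![0, 0, 1])

/-- The power product `a^i b^j c^k` as a function of `(i, j, k)`. -/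
def powers (a b c : Laurentˣ) : Multiplicative (Fin 3 → ℤ) →* Laurent where
  toFun v := ((a ^ (v.toAdd 0) * b ^ (v.toAdd 1) * c ^ (v.toAdd 2) : Laurentˣ) : Laurent)
  map_one' := by simp
  map_mul' v w := by
    rw [← Units.val_mul]
    congr 1
    simp only [toAdd_mul, Pi.add_apply, zpow_add]
    exact by ac_rfl

/-- The substitution `f(s, t, q) ↦ f(a, b, c)` of units for the three variables. -/
def subst (a b c : Laurentˣ) : Laurent →ₐ[ℤ] Laurent :=
  AddMonoidAlgebra.lift ℤ Laurent (Fin 3 → ℤ) (powers a b c)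

/-! ### The virtual Alexander polynomial -/

/-- The ideal generated by the `k × k` minors of a matrix. -/
def minorsIdeal {m n : Type*} {R : Type*} [CommRing R] (M : Matrix m n R) (k : ℕ) : Ideal R :=
  Ideal.span {d | ∃ (r : Fin k ↪ m) (c : Fin k ↪ n), d = (M.submatrix r c).det}

namespace DiagramData

variable (D : DiagramData)

/-- The values in `ℤ[s^{±1}, t^{±1}, q^{±1}]` of the generators of the virtual knot group under its
abelianization: each arc is sent to `t`. -/
def abValue : D.Generator → Laurentˣ
  | Generator.arc _ => t
  | Generator.s => s
  | Generator.q => q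

/-- The ring homomorphism from the integral group ring of the free group to
`ℤ[s^{±1}, t^{±1}, q^{±1}]` with `a ↦ t` for each arc `a`, `s ↦ s` and `q ↦ q`. -/
def alpha : MonoidAlgebra ℤ D.Free →ₐ[ℤ] Laurent :=
  MonoidAlgebra.lift ℤ Laurent D.Free ((Units.coeHom Laurent).comp (FreeGroup.lift D.abValue))

/-- The matrix of the Fox derivatives of all relators with respect to all generators (including
`s` and `q`), with values in `ℤ[s^{±1}, t^{±1}, q^{±1}]`: the presentation matrix `M` from
which the elementary ideals are computed. -/
def alexanderMatrix : Matrix D.Relation D.Generator Laurent :=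
  Matrix.of fun ρ x => D.alpha (fox x (D.relator ρ))

/-- The `0`-th elementary ideal: it is generated by the `(n + 1) × (n + 1)` minors of the matrix of
Fox derivatives, where `n` is the number of arcs, so that there are `n + 2` generators. -/
def elementaryIdeal : Ideal Laurent :=
  minorsIdeal D.alexanderMatrix (Fintype.card D.Arc + 1)

end DiagramData

/-- `H` is a virtual Alexander polynomial of the diagram: a generator of the smallest principal
ideal that contains the `0`-th elementary ideal, that is, a greatest common divisor of the minors.
-/
def Diagram.IsVirtualAlexanderPolynomial (D : Diagram) (H : Laurent) : Prop :=
  IsLeast {I : Ideal Laurent | I.IsPrincipal ∧ D.elementaryIdeal ≤ I} (Ideal.span {H})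

end

end VirtualLink

/-!
The Alexander matrix of a diagram without crossingless circles has `n + 1` rows and `n + 2` columns.
The row that belongs to `[s, q] = 1` is `(1 - q) ∂s + (s - 1) ∂q`, so that the minors without the
column `s` or `q` are, up to sign, `Δ (s - 1)` and `Δ (1 - q)`, where `Δ` is the determinant of the
`n × n` block `arcMatrix` (crossing relations against arcs).  By the fundamental formula of Fox
calculus the columns, multiplied by `t - 1`, `s - 1` and `q - 1`, add up to zero; by Cramer's rule
every minor is therefore a multiple of `Δ` (`dvd_minor`).  As `s - 1` and `1 - q` have no common
factor, `Δ` is the virtual Alexander polynomial (`isLeast_span_det`).  With a crossingless circle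
there are too few rows, and the polynomial is `0`.

The symmetry is a property of `Δ` alone.  A planar diagram has an Alexander numbering: the regions
can be numbered by integers such that the number drops by `1` across each arc from left to right
(`IsPlanar.exists_numbering`).  It exists because the sum of all arcs is a cycle and the first
homology of the sphere vanishes, which is what Euler's formula in `IsPlanar` says
(`IsPlanar.range_jump`).  If `μ` is the number of the region to the left of an arc, conjugation of
`arcMatrix` with the diagonal matrix of the powers `q ^ (-μ)` turns it into the matrix with
`s q⁻¹`, `t q`, `1` in place of `s`, `t`, `q`, so that `Δ` is invariant (`subst_det_arcMatrix`).
-/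

namespace VirtualLink

noncomputable section

/-! ### Fox calculus -/

section Fox

variable {X : Type*} [DecidableEq X]

theorem foxWord_append (x : X) (u v : List (X × Bool)) :
    foxWord x (u ++ v) = foxWord x u + MonoidAlgebra.of ℤ _ (FreeGroup.mk u) * foxWord x v := by
  induction u with
  | nil =>
    have h : (FreeGroup.mk [] : FreeGroup X) = 1 := rfl
    rw [h, map_one, one_mul, List.nil_append, foxWord, zero_add]
  | cons z u ih =>
    obtain ⟨y, _ | _⟩ := z
    · have h : FreeGroup.mk ((y, false) :: u) = (FreeGroup.of y)⁻¹ * FreeGroup.mk u := rfl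
      rw [List.cons_append, foxWord, foxWord, ih, h, map_mul]
      noncomm_ring
    · have h : FreeGroup.mk ((y, true) :: u) = FreeGroup.of y * FreeGroup.mk u := rfl
      rw [List.cons_append, foxWord, foxWord, ih, h, map_mul]
      noncomm_ring

theorem fox_mul (x : X) (u v : FreeGroup X) :
    fox x (u * v) = fox x u + MonoidAlgebra.of ℤ _ u * fox x v := by
  induction u using Quot.inductionOn with
  | _ u =>
    induction v using Quot.inductionOn with
    | _ v => exact foxWord_append x u v

theorem fox_of (x y : X) : fox x (FreeGroup.of y) = if y = x then 1 else 0 := by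
  change foxWord x [(y, true)] = _
  simp [foxWord]

theorem fox_one (x : X) : fox x (1 : FreeGroup X) = 0 := rfl

end Fox

namespace DiagramData

variable (D : DiagramData)

/-- The abelianization map of the free group that sends each arc to `t`, and `s` and `q` to the
variables of the same name. -/
def abHom : D.Free →* Laurentˣ := FreeGroup.lift D.abValue

/-- The Fox derivative with respect to `x`, evaluated in the Laurent polynomial ring. -/
def foxAb (x : D.Generator) (w : D.Free) : Laurent := D.alpha (fox x w)

theorem alpha_of (w : D.Free) : D.alpha (MonoidAlgebra.of ℤ _ w) = D.abHom w := by
  simp [alpha, abHom]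

@[simp] theorem abHom_of (x : D.Generator) : D.abHom (FreeGroup.of x) = D.abValue x := by
  simp [abHom]

theorem foxAb_mul (x : D.Generator) (u v : D.Free) :
    D.foxAb x (u * v) = D.foxAb x u + D.abHom u * D.foxAb x v := by
  rw [foxAb, fox_mul, map_add, map_mul, alpha_of]; rfl

theorem foxAb_of (x y : D.Generator) :
    D.foxAb x (FreeGroup.of y) = if y = x then 1 else 0 := by
  rw [foxAb, fox_of]; split <;> simp

theorem foxAb_one (x : D.Generator) : D.foxAb x 1 = 0 := by
  rw [foxAb, fox_one, map_zero]

theorem foxAb_inv (x : D.Generator) (u : D.Free) :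
    D.foxAb x u⁻¹ = -(((D.abHom u)⁻¹ : Laurentˣ) : Laurent) * D.foxAb x u := by
  have h := D.foxAb_mul x u⁻¹ u
  rw [inv_mul_cancel, foxAb_one, map_inv] at h
  linear_combination -h

/-- The fundamental formula of Fox calculus: the derivatives of a word determine its value. -/
theorem sum_foxAb_mul (w : D.Free) :
    ∑ x, D.foxAb x w * ((D.abValue x : Laurent) - 1) = (D.abHom w : Laurent) - 1 := by
  induction w using FreeGroup.induction_on with
  | C1 => simp [foxAb_one]
  | of y => simp [foxAb_of]
  | inv_of y h =>
    simp only [foxAb_inv, mul_assoc, ← Finset.mul_sum, h, map_inv]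
    rw [mul_sub, neg_mul, Units.inv_mul]
    ring
  | mul u v hu hv =>
    simp only [foxAb_mul, add_mul, mul_assoc, Finset.sum_add_distrib, ← Finset.mul_sum, hu, hv,
      map_mul, Units.val_mul]
    ring

/-! ### The matrix of Fox derivatives -/

@[simp] theorem abHom_fs : D.abHom D.fs = s := D.abHom_of _
@[simp] theorem abHom_fq : D.abHom D.fq = q := D.abHom_of _
@[simp] theorem abHom_fin (c a) : D.abHom (D.fin c a) = t := D.abHom_of _
@[simp] theorem abHom_fout (c a) : D.abHom (D.fout c a) = t := D.abHom_of _

theorem abHom_outWord (c : Fin D.numCrossings) (a : Side) : D.abHom (D.outWord c a) = t := by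
  unfold outWord
  split <;> simp [mul_comm]

theorem abHom_relator (ρ : D.Relation) : D.abHom (D.relator ρ) = 1 := by
  cases ρ <;> simp [relator, abHom_outWord, mul_comm]

theorem foxAb_relator_crossing (x : D.Generator) (c : Fin D.numCrossings) (a : Side) :
    D.foxAb x (D.relator (Relation.crossing c a)) =
      D.foxAb x (D.fout c a) - D.foxAb x (D.outWord c a) := by
  rw [relator, foxAb_mul, foxAb_inv, abHom_outWord, abHom_fout, neg_mul, mul_neg,
    Units.mul_inv_cancel_left, sub_eq_add_neg]

theorem foxAb_relator_comm (x : D.Generator) :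
    D.foxAb x (D.relator Relation.comm) =
      (1 - (q : Laurent)) * D.foxAb x D.fs + ((s : Laurent) - 1) * D.foxAb x D.fq := by
  simp only [relator, foxAb_mul, foxAb_inv, abHom_fs, abHom_fq, map_mul, map_inv]
  have h : s * q * s⁻¹ * q⁻¹ = (1 : Laurentˣ) := by simp [mul_comm]
  have h' : s * q * s⁻¹ = (q : Laurentˣ) := by simp [mul_comm]
  have h2 := congrArg Units.val h
  have h3 := congrArg Units.val h'
  simp only [Units.val_mul, Units.val_one] at h2 h3 ⊢
  linear_combination (-D.foxAb x D.fs) * h3 - D.foxAb x D.fq * h2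

/-- The coefficient of the bottom left (`b = left`) or bottom right (`b = right`) arc of a crossing
in the Fox derivative of the word prescribed for its outgoing arc on side `a`. -/
def coef : CrossingType → Side → Side → Laurent
  | .positive, .right, .left => s
  | .positive, .right, .right => 0
  | .positive, .left, .left => 1 - t * s
  | .positive, .left, .right => t
  | .negative, .left, .left => 0
  | .negative, .left, .right => (s⁻¹ : Laurentˣ)
  | .negative, .right, .left => (t⁻¹ : Laurentˣ)
  | .negative, .right, .right => 1 - (s⁻¹ * t⁻¹ : Laurentˣ)
  | .virtual, .right, .left => q
  | .virtual, .right, .right => 0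
  | .virtual, .left, .left => 0
  | .virtual, .left, .right => (q⁻¹ : Laurentˣ)

theorem foxAb_outWord (e : D.Arc) (c : Fin D.numCrossings) (a : Side) :
    D.foxAb (.arc e) (D.outWord c a) =
      coef (D.type c) a .left * (if D.inArc c .left = e then 1 else 0) +
      coef (D.type c) a .right * (if D.inArc c .right = e then 1 else 0) := by
  have hs : D.foxAb (.arc e) D.fs = 0 := by rw [fs, foxAb_of, if_neg nofun]
  have hq : D.foxAb (.arc e) D.fq = 0 := by rw [fq, foxAb_of, if_neg nofun]
  have hin (b) : D.foxAb (.arc e) (D.fin c b) = if D.inArc c b = e then 1 else 0 := by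
    rw [fin, foxAb_of]; simp
  have ht := Units.mul_inv t
  have ht' := Units.mul_inv s
  unfold outWord
  cases D.type c <;> cases a <;>
    simp only [coef, foxAb_mul, foxAb_inv, hs, hq, hin, map_mul, map_inv, abHom_fs, abHom_fq,
      abHom_fin, Units.val_mul]
  · linear_combination (-(t:Laurent) * s * (if D.inArc c .left = e then 1 else 0)) * ht
  · ring
  · ring
  · linear_combination ((t⁻¹ : Laurentˣ) : Laurent) *
      (if D.inArc c .left = e then 1 else 0) * ht' +
      (if D.inArc c .right = e then 1 else 0) * (ht + (t : Laurent) * (t⁻¹ : Laurentˣ) * ht')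
  · ring
  · ring

/-- The block of the matrix of Fox derivatives that belongs to the arcs between crossings: the rows
are the relations at the crossings and the columns are the arcs. -/
def arcMatrix : Matrix (Fin D.numCrossings × Side) (Fin D.numCrossings × Side) Laurent :=
  Matrix.of fun e f => D.alexanderMatrix (.crossing e.1 e.2) (.arc (Sum.inl f))

theorem arcMatrix_apply (c : Fin D.numCrossings) (a : Side) (f : Fin D.numCrossings × Side) :
    D.arcMatrix (c, a) f = (if (c, a) = f then 1 else 0) -
      (coef (D.type c) a .left * (if D.next.symm (c, .left) = f then 1 else 0) +
      coef (D.type c) a .right * (if D.next.symm (c, .right) = f then 1 else 0)) := by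
  change D.foxAb _ _ = _
  rw [foxAb_relator_crossing, foxAb_outWord, fout, foxAb_of]
  simp [inArc, outArc]

end DiagramData

/-! ### Alexander numberings of planar diagrams -/

theorem Side.sum_eq {M : Type*} [AddCommMonoid M] (f : Side → M) :
    ∑ a, f a = f .left + f .right := by
  change ∑ a ∈ {Side.left, Side.right}, f a = _
  rw [Finset.sum_pair (by decide)]

theorem Side.card_eq : Fintype.card Side = 2 := rfl

namespace DiagramData

variable (D : DiagramData)

/-- The region on the left-hand side (`b = true`) or on the right-hand side (`b = false`) of an
arc. -/
def face (e : Fin D.numCrossings × Side) (b : Bool) : D.Face := Quot.mk _ (e, b)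

theorem face_turn (x : D.Dart) : D.face (D.turn x).1 (D.turn x).2 = D.face x.1 x.2 :=
  (Quot.sound (r := fun x y : D.Dart => D.turn x = y) (rfl : D.turn x = _)).symm

/-! The regions at a crossing are named west, south, north and east. -/

theorem face_west (c : Fin D.numCrossings) :
    D.face (D.next.symm (c, .left)) true = D.face (c, .left) true := by
  simpa [turn] using (D.face_turn (D.next.symm (c, .left), true)).symm

theorem face_south (c : Fin D.numCrossings) :
    D.face (D.next.symm (c, .right)) true = D.face (D.next.symm (c, .left)) false := by
  simpa [turn] using (D.face_turn (D.next.symm (c, .right), true)).symm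

theorem face_north (c : Fin D.numCrossings) :
    D.face (c, .left) false = D.face (c, .right) true :=
  (D.face_turn ((c, .left), false)).symm

theorem face_east (c : Fin D.numCrossings) :
    D.face (c, .right) false = D.face (D.next.symm (c, .right)) false :=
  (D.face_turn ((c, .right), false)).symm

/-- The incidence matrix of the underlying four-valent graph. -/
def incidence : Matrix (Fin D.numCrossings) (Fin D.numCrossings × Side) ℚ :=
  Matrix.of fun c e => (if (D.next e).1 = c then 1 else 0) - if e.1 = c then 1 else 0

theorem incidence_mulVec (z : Fin D.numCrossings × Side → ℚ) (c : Fin D.numCrossings) :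
    D.incidence.mulVec z c = (z (D.next.symm (c, .left)) + z (D.next.symm (c, .right))) -
      (z (c, .left) + z (c, .right)) := by
  have h (y : Fin D.numCrossings × Side → ℚ) :
      ∑ e, (if e.1 = c then 1 else 0) * y e = y (c, .left) + y (c, .right) := by
    rw [Fintype.sum_prod_type, Finset.sum_eq_single c]
    · simp [Side.sum_eq]
    · intro b _ hb
      simp [hb]
    · simp
  have h' : ∑ e, (if (D.next e).1 = c then 1 else 0) * z e =
      z (D.next.symm (c, .left)) + z (D.next.symm (c, .right)) := by
    rw [← h (fun e => z (D.next.symm e)),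
      ← Equiv.sum_comp D.next fun e => (if e.1 = c then 1 else 0) * z (D.next.symm e)]
    simp
  simp only [Matrix.mulVec, dotProduct, incidence, Matrix.of_apply, sub_mul,
    Finset.sum_sub_distrib, h, h']

theorem incidence_transpose_mulVec (f : Fin D.numCrossings → ℚ) (e : Fin D.numCrossings × Side) :
    D.incidence.transpose.mulVec f e = f (D.next e).1 - f e.1 := by
  simp [Matrix.mulVec, dotProduct, incidence, sub_mul, Finset.sum_sub_distrib]

/-- The jump of a function on the regions across each arc. -/
def jump : (D.Face → ℚ) →ₗ[ℚ] (Fin D.numCrossings × Side → ℚ) where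
  toFun g e := g (D.face e true) - g (D.face e false)
  map_add' g h := by ext e; simp only [Pi.add_apply]; ring
  map_smul' r g := by ext e; simp only [Pi.smul_apply, smul_eq_mul, RingHom.id_apply]; ring

/-- The four regions at a crossing contribute with cancelling signs, so that a jump is a cycle. -/
theorem range_jump_le : LinearMap.range D.jump ≤ LinearMap.ker D.incidence.mulVecLin := by
  rintro _ ⟨g, rfl⟩
  rw [LinearMap.mem_ker]
  ext c
  rw [Matrix.mulVecLin_apply, incidence_mulVec]
  simp only [jump, LinearMap.coe_mk, AddHom.coe_mk, face_west, face_south, face_north, face_east,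
    Pi.zero_apply]
  ring

/-- A potential with vanishing coboundary is a function on the set of components. -/
theorem finrank_ker_incidence_transpose_le :
    Module.finrank ℚ (LinearMap.ker D.incidence.transpose.mulVecLin) ≤ Nat.card D.Component := by
  classical
  have := Fintype.ofFinite D.Component
  rw [Nat.card_eq_fintype_card, ← Module.finrank_fintype_fun_eq_card (R := ℚ)]
  let pull : (D.Component → ℚ) →ₗ[ℚ] (Fin D.numCrossings → ℚ) :=
    LinearMap.funLeft ℚ ℚ (Quot.mk _)
  refine (Submodule.finrank_mono ?_).trans (LinearMap.finrank_range_le pull)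
  intro f hf
  refine ⟨Quot.lift f ?_, rfl⟩
  rintro c d ⟨a, b, h⟩
  have := congrFun (LinearMap.mem_ker.1 hf) (c, a)
  rw [Matrix.mulVecLin_apply, incidence_transpose_mulVec, h, Pi.zero_apply] at this
  exact (sub_eq_zero.1 this).symm

/-- A function on the regions without jumps takes the same value on all regions that meet a given
component of the graph. -/
theorem finrank_ker_jump_le :
    Module.finrank ℚ (LinearMap.ker D.jump) ≤ Nat.card D.Component := by
  classical
  have := Fintype.ofFinite D.Component
  rw [Nat.card_eq_fintype_card, ← Module.finrank_fintype_fun_eq_card (R := ℚ)]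
  let pull : (D.Component → ℚ) →ₗ[ℚ] (Fin D.numCrossings → ℚ) :=
    LinearMap.funLeft ℚ ℚ (Quot.mk _)
  -- evaluation at the region to the west of each crossing
  let west : (D.Face → ℚ) →ₗ[ℚ] (Fin D.numCrossings → ℚ) :=
    LinearMap.funLeft ℚ ℚ fun c => D.face (c, .left) true
  have key (g : D.Face → ℚ) (hg : g ∈ LinearMap.ker D.jump) (c : Fin D.numCrossings) (a : Side)
      (b : Bool) : g (D.face (c, a) b) = west g c ∧
        g (D.face (D.next.symm (c, a)) b) = west g c := by
    have hj (e) : g (D.face e true) = g (D.face e false) :=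
      sub_eq_zero.1 (congrFun (LinearMap.mem_ker.1 hg) e)
    have h1 := congrArg g (D.face_west c)
    have h2 := congrArg g (D.face_south c)
    have h3 := congrArg g (D.face_north c)
    have h4 := hj (c, .left)
    have h5 := hj (c, .right)
    have h6 := hj (D.next.symm (c, .left))
    have h7 := hj (D.next.symm (c, .right))
    change _ = g (D.face (c, .left) true) ∧ _ = g (D.face (c, .left) true)
    cases a <;> cases b <;> constructor <;> linarith
  have hinj : Function.Injective (west.domRestrict (LinearMap.ker D.jump)) := by
    rw [← LinearMap.ker_eq_bot, LinearMap.ker_eq_bot']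
    rintro ⟨g, hg⟩ h
    ext φ
    induction φ using Quot.inductionOn with
    | _ x =>
      obtain ⟨⟨c, a⟩, b⟩ := x
      exact ((key g hg c a b).1).trans (congrFun h c)
  rw [← LinearMap.finrank_range_of_inj hinj]
  refine (Submodule.finrank_mono ?_).trans (LinearMap.finrank_range_le pull)
  rintro _ ⟨⟨g, hg⟩, rfl⟩
  refine ⟨Quot.lift (west g) ?_, rfl⟩
  rintro c d ⟨a, b, h⟩
  rw [← (key g hg c a true).1, ← (key g hg d b true).2, ← h, Equiv.symm_apply_apply]

/-- On a planar diagram each cycle is the jump of a function on the regions: the first homology of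
the sphere vanishes. -/
theorem IsPlanar.range_jump {D : DiagramData} (h : D.IsPlanar) :
    LinearMap.range D.jump = LinearMap.ker D.incidence.mulVecLin := by
  classical
  have := Fintype.ofFinite D.Face
  refine Submodule.eq_of_le_of_finrank_le D.range_jump_le ?_
  have h1 := LinearMap.finrank_range_add_finrank_ker D.jump
  have h2 := LinearMap.finrank_range_add_finrank_ker D.incidence.mulVecLin
  have h3 := LinearMap.finrank_range_add_finrank_ker D.incidence.transpose.mulVecLin
  have h4 := D.incidence.rank_transpose
  rw [Matrix.rank, Matrix.rank] at h4
  have h5 := D.finrank_ker_incidence_transpose_le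
  have h6 := D.finrank_ker_jump_le
  rw [Module.finrank_fintype_fun_eq_card] at h1 h2 h3
  rw [Fintype.card_prod, Side.card_eq, Fintype.card_fin] at h2
  rw [Fintype.card_fin] at h3
  rw [IsPlanar, Nat.card_eq_fintype_card (α := D.Face)] at h
  omega

/-- The Alexander numbering of a planar diagram, as a function on the arcs (the number of an arc
is that of the region to its left). -/
theorem IsPlanar.exists_numbering {D : DiagramData} (h : D.IsPlanar) :
    ∃ μ : Fin D.numCrossings × Side → ℤ, (∀ e, μ (D.next.symm e) = μ e) ∧
      ∀ c, μ (c, .right) = μ (c, .left) - 1 := by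
  -- each crossing has two incoming and two outgoing ends, so the sum of all arcs is a cycle
  have h1 : (fun _ => 1) ∈ LinearMap.range D.jump := by
    rw [h.range_jump, LinearMap.mem_ker]
    ext c
    rw [Matrix.mulVecLin_apply, incidence_mulVec]
    simp
  obtain ⟨g, hg⟩ := h1
  have hj (e) : g (D.face e true) - g (D.face e false) = 1 := congrFun hg e
  have hr (c) : g (D.face (c, .right) true) = g (D.face (c, .left) true) - 1 := by
    rw [← face_north]; linarith [hj (c, .left)]
  -- taking integral parts turns a rational solution into an integral one
  refine ⟨fun e => ⌊g (D.face e true)⌋, ?_, fun c => ?_⟩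
  · rintro ⟨c, _ | _⟩
    · simp only [face_west]
    · simp only
      rw [face_south, hr, ← face_west, ← hj (D.next.symm (c, .left)), sub_sub_cancel]
  · simp only [hr, Int.floor_sub_one]

end DiagramData

/-! ### Laurent polynomials -/

theorem coe_monomial (v : Multiplicative (Fin 3 → ℤ)) :
    (monomial v : Laurent) = AddMonoidAlgebra.of ℤ (Fin 3 → ℤ) v := rfl

theorem monomial_eq (v : Multiplicative (Fin 3 → ℤ)) :
    monomial v = s ^ v.toAdd 0 * t ^ v.toAdd 1 * q ^ v.toAdd 2 := by
  have h : v = Multiplicative.ofAdd ![1, 0, 0] ^ v.toAdd 0 *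
      Multiplicative.ofAdd ![0, 1, 0] ^ v.toAdd 1 * Multiplicative.ofAdd ![0, 0, 1] ^ v.toAdd 2 := by
    apply Multiplicative.toAdd.injective
    ext i
    fin_cases i <;> simp
  conv_lhs => rw [h]
  rw [map_mul, map_mul, map_zpow, map_zpow, map_zpow, s, t, q]

theorem subst_monomial (a b c : Laurentˣ) (v : Multiplicative (Fin 3 → ℤ)) :
    subst a b c (monomial v) =
      ((a ^ v.toAdd 0 * b ^ v.toAdd 1 * c ^ v.toAdd 2 : Laurentˣ) : Laurent) := by
  rw [coe_monomial, subst, AddMonoidAlgebra.lift_of]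
  rfl

@[simp] theorem subst_s (a b c : Laurentˣ) : subst a b c s = a := by
  rw [s, subst_monomial]; simp

@[simp] theorem subst_t (a b c : Laurentˣ) : subst a b c t = b := by
  rw [t, subst_monomial]; simp

@[simp] theorem subst_q (a b c : Laurentˣ) : subst a b c q = c := by
  rw [q, subst_monomial]; simp

theorem subst_inv (a b c u v : Laurentˣ) (h : subst a b c u = v) :
    subst a b c (u⁻¹ : Laurentˣ) = (v⁻¹ : Laurentˣ) := by
  have : Units.map (subst a b c : Laurent →* Laurent) u = v := Units.ext h
  rw [← this, ← map_inv]
  rfl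

theorem s_sub_one_ne_zero : (s : Laurent) - 1 ≠ 0 := by
  intro h
  rw [sub_eq_zero, s, coe_monomial, ← map_one (AddMonoidAlgebra.of ℤ (Fin 3 → ℤ))] at h
  have := congrFun (congrArg Multiplicative.toAdd (AddMonoidAlgebra.of_injective h)) 0
  simp at this

theorem one_sub_q_ne_zero : 1 - (q : Laurent) ≠ 0 := by
  intro h
  rw [sub_eq_zero, q, coe_monomial, ← map_one (AddMonoidAlgebra.of ℤ (Fin 3 → ℤ))] at h
  have := congrFun (congrArg Multiplicative.toAdd (AddMonoidAlgebra.of_injective h)) 2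
  simp at this

/-- The kernel of the substitution `s ↦ 1` is generated by `s - 1`: modulo `s - 1` the substitution
is the identity. -/
theorem s_sub_one_dvd_sub_subst (f : Laurent) : (s : Laurent) - 1 ∣ f - subst 1 t q f := by
  rw [← Ideal.mem_span_singleton, ← Ideal.Quotient.eq]
  set I := Ideal.span {(s : Laurent) - 1}
  suffices h : Ideal.Quotient.mkₐ ℤ I = (Ideal.Quotient.mkₐ ℤ I).comp (subst 1 t q) from
    congrArg (fun φ => φ f) h
  have hs : Units.map (Ideal.Quotient.mkₐ ℤ I).toRingHom.toMonoidHom s = 1 := by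
    apply Units.ext
    exact Ideal.Quotient.eq.2 (Ideal.mem_span_singleton_self _)
  refine AddMonoidAlgebra.algHom_ext (fun v => ?_) (Subsingleton.elim _ _)
  change Ideal.Quotient.mkₐ ℤ I (monomial (.ofAdd v) : Laurent) =
    Ideal.Quotient.mkₐ ℤ I (subst 1 t q (monomial (.ofAdd v) : Laurent))
  rw [subst_monomial, monomial_eq]
  have (u : Laurentˣ) : Ideal.Quotient.mkₐ ℤ I (u : Laurent) =
    (Units.map (Ideal.Quotient.mkₐ ℤ I).toRingHom.toMonoidHom u : (Laurent ⧸ I)ˣ) := rfl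
  rw [this, this]
  simp only [map_mul, map_zpow, hs, map_one]

/-- The elements `s - 1` and `1 - q` have no common factor: the quotient by `s - 1` is a domain in
which `1 - q` is not zero. -/
theorem dvd_of_dvd_mul_s_sub_one {g f : Laurent} (hs : g ∣ f * ((s : Laurent) - 1))
    (hq : g ∣ f * (1 - (q : Laurent))) : g ∣ f := by
  obtain ⟨a, ha⟩ := hs
  obtain ⟨b, hb⟩ := hq
  rcases eq_or_ne g 0 with rfl | hg
  · rw [zero_mul] at ha
    rw [(mul_eq_zero.1 ha).resolve_right s_sub_one_ne_zero]
  have h : a * (1 - (q : Laurent)) = b * ((s : Laurent) - 1) :=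
    mul_left_cancel₀ hg (by linear_combination (-(1 - (q : Laurent))) * ha + (s - 1 : Laurent) * hb)
  have ha0 : subst 1 t q a = 0 := by
    have := congrArg (subst 1 t q) h
    simp only [map_mul, map_sub, map_one, subst_s, subst_q, Units.val_one, sub_self,
      mul_zero] at this
    exact (mul_eq_zero.1 this).resolve_right one_sub_q_ne_zero
  obtain ⟨k, hk⟩ := s_sub_one_dvd_sub_subst a
  rw [ha0, sub_zero] at hk
  refine ⟨k, mul_right_cancel₀ s_sub_one_ne_zero ?_⟩
  rw [ha, hk]
  ring

/-! ### The minors of the matrix of Fox derivatives -/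

/-- Choosing rows and columns, possibly with repetitions, amounts to multiplying by `0`-`1` matrices
on both sides. -/
theorem det_dvd_det_submatrix {m k R : Type*} [Fintype m] [DecidableEq m] [Fintype k]
    [DecidableEq k] [CommRing R] (N : Matrix m m R) (ε : k ≃ m) (e f : k → m) :
    N.det ∣ (N.submatrix e f).det := by
  have h : (N.submatrix e f).submatrix ε.symm ε.symm =
      (1 : Matrix m m R).submatrix (e ∘ ε.symm) id * N *
        (1 : Matrix m m R).submatrix id (f ∘ ε.symm) := by
    ext i j : 2
    simp [Matrix.mul_apply, Matrix.one_apply]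
  rw [← Matrix.det_submatrix_equiv_self ε.symm, h, Matrix.det_mul, Matrix.det_mul]
  exact (dvd_mul_left _ _).mul_right _

namespace DiagramData

variable (D : DiagramData)

/-- The relations, as those at the crossings together with the commutation relation. -/
def rowEquiv : (Fin D.numCrossings × Side) ⊕ Unit ≃ D.Relation where
  toFun := Sum.elim (fun e => .crossing e.1 e.2) fun _ => .comm
  invFun
    | .crossing c a => Sum.inl (c, a)
    | .comm => Sum.inr ()
  left_inv := by rintro (_ | _) <;> rfl
  right_inv := by rintro (_ | _) <;> rfl

/-- The arcs between crossings, together with one further generator. -/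
def column (x : D.Generator) : (Fin D.numCrossings × Side) ⊕ Unit → D.Generator :=
  Sum.elim (fun e => .arc (Sum.inl e)) fun _ => x

theorem alexanderMatrix_comm_arc (e : D.Arc) : D.alexanderMatrix .comm (.arc e) = 0 := by
  change D.foxAb _ _ = _
  rw [foxAb_relator_comm, fs, fq, foxAb_of, foxAb_of, if_neg nofun, if_neg nofun]
  simp

theorem alexanderMatrix_comm_s : D.alexanderMatrix .comm .s = 1 - (q : Laurent) := by
  change D.foxAb _ _ = _
  rw [foxAb_relator_comm, fs, fq, foxAb_of, foxAb_of, if_pos rfl, if_neg nofun]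
  simp

theorem alexanderMatrix_comm_q : D.alexanderMatrix .comm .q = (s : Laurent) - 1 := by
  change D.foxAb _ _ = _
  rw [foxAb_relator_comm, fs, fq, foxAb_of, foxAb_of, if_pos rfl, if_neg nofun]
  simp

theorem det_submatrix_column (x : D.Generator) :
    (D.alexanderMatrix.submatrix D.rowEquiv (D.column x)).det =
      D.arcMatrix.det * D.alexanderMatrix .comm x := by
  have h : D.alexanderMatrix.submatrix D.rowEquiv (D.column x) =
      Matrix.fromBlocks D.arcMatrix (Matrix.of fun e _ => D.alexanderMatrix (.crossing e.1 e.2) x)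
        0 (Matrix.of fun _ _ => D.alexanderMatrix .comm x) := by
    refine Matrix.ext ?_
    rintro (i | i) (j | j)
    · rfl
    · rfl
    · exact D.alexanderMatrix_comm_arc _
    · rfl
  rw [h, Matrix.det_fromBlocks_zero₂₁, Matrix.det_unique (n := Unit)]
  rfl

theorem alexanderMatrix_mulVec (ρ : D.Relation) :
    ∑ x, D.alexanderMatrix ρ x * ((D.abValue x : Laurent) - 1) = 0 := by
  have := D.sum_foxAb_mul (D.relator ρ)
  rwa [abHom_relator, Units.val_one, sub_self] at this

theorem card_generator : Fintype.card D.Generator = Fintype.card D.Arc + 2 := by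
  let e : D.Generator ≃ D.Arc ⊕ Bool :=
    { toFun := fun | .arc a => .inl a | .s => .inr true | .q => .inr false
      invFun := fun | .inl a => .arc a | .inr true => .s | .inr false => .q
      left_inv := by rintro (_ | _ | _) <;> rfl
      right_inv := by rintro (_ | _ | _) <;> rfl }
  rw [Fintype.card_congr e, Fintype.card_sum, Fintype.card_bool]

variable {D}

/-- An enumeration of the rows, when there are no circles without crossings. -/
def finEquiv (h : D.numCircles = 0) :
    Fin (Fintype.card D.Arc + 1) ≃ (Fin D.numCrossings × Side) ⊕ Unit :=
  Fintype.equivOfCardEq (by simp [h])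

theorem det_column_mem_elementaryIdeal (h : D.numCircles = 0) (x : D.Generator)
    (hx : ∀ e, x ≠ .arc e) :
    D.arcMatrix.det * D.alexanderMatrix .comm x ∈ D.elementaryIdeal := by
  have hc : Function.Injective (D.column x) := by
    rintro (e | _) (f | _) hef
    · simpa [column] using hef
    · exact (hx _ hef.symm).elim
    · exact (hx _ hef).elim
    · rfl
  refine Ideal.subset_span ⟨((finEquiv h).trans D.rowEquiv).toEmbedding,
    (finEquiv h).toEmbedding.trans ⟨_, hc⟩, ?_⟩
  rw [← det_submatrix_column, ← Matrix.det_submatrix_equiv_self (finEquiv h)]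
  rfl

theorem dvd_minor_of_ne_s (h : D.numCircles = 0) (r : Fin (Fintype.card D.Arc + 1) → D.Relation)
    (c : Fin (Fintype.card D.Arc + 1) → D.Generator) (hc : ∀ i, c i ≠ .s) :
    D.arcMatrix.det * ((s : Laurent) - 1) ∣ (D.alexanderMatrix.submatrix r c).det := by
  have hcol (i) : ∃ x, D.column .q x = c i := by
    rcases hi : c i with (e | e) | _ | _
    · exact ⟨.inl e, rfl⟩
    · exact (Fin.cast h e).elim0
    · exact (hc i hi).elim
    · exact ⟨.inr (), rfl⟩
  choose c' hc' using hcol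
  have := det_dvd_det_submatrix (D.alexanderMatrix.submatrix D.rowEquiv (D.column .q))
    (finEquiv h) (D.rowEquiv.symm ∘ r) c'
  rw [det_submatrix_column, alexanderMatrix_comm_q, Matrix.submatrix_submatrix] at this
  convert this using 3
  · ext i; simp
  · ext i; exact (hc' i).symm

/-- Every minor of the elementary ideal is a multiple of the determinant of the arc matrix.  A
minor whose columns include `s` is compared by Cramer's rule with the minor in which the column `s`
is replaced by the missing one: the columns, multiplied by `t - 1`, `s - 1` and `q - 1`, add up to
zero. -/
theorem dvd_minor (h : D.numCircles = 0) (r : Fin (Fintype.card D.Arc + 1) → D.Relation)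
    (c : Fin (Fintype.card D.Arc + 1) ↪ D.Generator) :
    D.arcMatrix.det ∣ (D.alexanderMatrix.submatrix r c).det := by
  by_cases hc : ∀ i, c i ≠ .s
  · exact (dvd_mul_right _ _).trans (dvd_minor_of_ne_s h r c hc)
  push Not at hc
  obtain ⟨i, hi⟩ := hc
  obtain ⟨x, hx⟩ : ∃ x, ∀ j, c j ≠ x := by
    by_contra! hsurj
    have := Fintype.card_le_of_surjective c hsurj
    rw [card_generator, Fintype.card_fin] at this
    omega
  set N := D.alexanderMatrix.submatrix r c with hN
  let w (y : D.Generator) : Laurent := (D.abValue y : Laurent) - 1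
  have hbij : Function.Bijective (Sum.elim c fun _ : Unit => x) := by
    rw [Fintype.bijective_iff_injective_and_card]
    constructor
    · rintro (j | _) (k | _) hjk
      · rw [c.injective hjk]
      · exact (hx _ hjk).elim
      · exact (hx _ hjk.symm).elim
      · rfl
    · rw [card_generator]; simp
  have hmul : N.mulVec (w ∘ c) = -w x • fun j => D.alexanderMatrix (r j) x := by
    ext j : 1
    have := D.alexanderMatrix_mulVec (r j)
    rw [← hbij.sum_comp, Fintype.sum_sum_type] at this
    simp only [Sum.elim_inl, Sum.elim_inr, Finset.univ_unique, Finset.sum_singleton] at this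
    simp only [Matrix.mulVec, dotProduct, hN, Matrix.submatrix_apply, Function.comp_apply, w,
      Pi.smul_apply, smul_eq_mul]
    linear_combination this
  have hupd : N.updateCol i (fun j => D.alexanderMatrix (r j) x) =
      D.alexanderMatrix.submatrix r (Function.update c i x) := by
    ext j k : 2
    rcases eq_or_ne k i with rfl | hk
    · simp
    · simp [hk, hN]
  have hcr : N.det * ((s : Laurent) - 1) =
      -w x * (D.alexanderMatrix.submatrix r (Function.update c i x)).det := by
    -- apply the adjugate of `N` to `hmul` and compare the coordinates at the position of `s`
    have h1 := congrFun (Matrix.cramer_eq_adjugate_mulVec N (N.mulVec (w ∘ c))) i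
    rw [Matrix.mulVec_mulVec, Matrix.adjugate_mul, Matrix.smul_mulVec, Matrix.one_mulVec, hmul,
      map_smul, Pi.smul_apply, Matrix.cramer_apply, hupd] at h1
    rw [Pi.smul_apply, Function.comp_apply, hi, smul_eq_mul, smul_eq_mul] at h1
    exact h1.symm
  obtain ⟨k, hk⟩ := dvd_minor_of_ne_s h r (Function.update c i x) fun j => by
    rcases eq_or_ne j i with rfl | hj
    · rw [Function.update_self, ← hi]
      exact (hx _).symm
    · rw [Function.update_of_ne hj, ← hi]
      exact fun hji => hj (c.injective hji)
  refine ⟨-w x * k, mul_right_cancel₀ s_sub_one_ne_zero ?_⟩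
  rw [hcr, hk]
  ring

theorem isLeast_span_det (h : D.numCircles = 0) :
    IsLeast {I : Ideal Laurent | I.IsPrincipal ∧ D.elementaryIdeal ≤ I}
      (Ideal.span {D.arcMatrix.det}) := by
  refine ⟨⟨⟨_, rfl⟩, Ideal.span_le.2 ?_⟩, ?_⟩
  · rintro _ ⟨r, c, rfl⟩
    exact Ideal.mem_span_singleton.2 (dvd_minor h r c)
  · rintro I ⟨⟨g, rfl⟩, hI⟩
    have hq := hI (det_column_mem_elementaryIdeal h .q nofun)
    have hs := hI (det_column_mem_elementaryIdeal h .s nofun)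
    rw [alexanderMatrix_comm_q] at hq
    rw [alexanderMatrix_comm_s] at hs
    exact Ideal.span_singleton_le_span_singleton.2 (dvd_of_dvd_mul_s_sub_one
      (Ideal.mem_span_singleton.1 hq) (Ideal.mem_span_singleton.1 hs))

/-- If there is a circle without crossings, the matrix has fewer than `n + 1` rows. -/
theorem elementaryIdeal_eq_bot (h : D.numCircles ≠ 0) : D.elementaryIdeal = ⊥ := by
  rw [elementaryIdeal, minorsIdeal, Ideal.span_eq_bot]
  rintro _ ⟨r, -, -⟩
  have := Fintype.card_le_of_embedding r
  rw [← Fintype.card_congr D.rowEquiv] at this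
  simp at this
  omega

/-! ### The change of variables -/

/-- Conjugation by powers of `q` has the effect of the change of variables on each entry of the
crossing relations, where the numbers of the arcs at a crossing enter through its two sides. -/
theorem coef_subst (T : CrossingType) (a b : Side) (μ : Side → ℤ)
    (hμ : μ .right = μ .left - 1) :
    coef T a b * (q ^ (-μ b) : Laurentˣ) =
      (q ^ (-μ a) : Laurentˣ) * subst (s * q⁻¹) (t * q) 1 (coef T a b) := by
  have hr : q ^ (-μ .right) = q ^ (-μ .left) * q := by
    rw [hμ, neg_sub, sub_eq_add_neg, add_comm, zpow_add, zpow_one]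
  have hs := subst_inv (s * q⁻¹) (t * q) 1 s _ (subst_s _ _ _)
  have ht := subst_inv (s * q⁻¹) (t * q) 1 t _ (subst_t _ _ _)
  have hq := subst_inv (s * q⁻¹) (t * q) 1 q _ (subst_q _ _ _)
  have hqq := Units.mul_inv q
  obtain ⟨x, hl⟩ : ∃ x, q ^ (-μ .left) = x := ⟨_, rfl⟩
  rw [hl] at hr
  cases T <;> cases a <;> cases b <;>
    simp only [coef, hl, hr, map_sub, map_one, map_zero, map_mul, subst_s, subst_t, subst_q, hs, ht,
      hq, Units.val_mul, mul_inv, inv_inv, inv_one, Units.val_one]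
  · linear_combination ((x : Laurent) * t * s) * hqq
  · ring
  · linear_combination (-(x : Laurent) * s) * hqq
  · ring
  · ring
  · ring
  · linear_combination (-(x : Laurent) * (t⁻¹ : Laurentˣ)) * hqq
  · linear_combination ((x : Laurent) * q * (s⁻¹ : Laurentˣ) * (t⁻¹ : Laurentˣ)) * hqq
  · ring
  · linear_combination (x : Laurent) * hqq
  · ring
  · ring

/-- The determinant of the arc matrix is invariant under the change of variables, since the
matrices before and after it are conjugate by the diagonal matrix of the powers of `q` given by an
Alexander numbering. -/
theorem subst_det_arcMatrix (h : D.IsPlanar) :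
    subst (s * q⁻¹) (t * q) 1 D.arcMatrix.det = D.arcMatrix.det := by
  obtain ⟨μ, hnext, hμ⟩ := h.exists_numbering
  let P := Matrix.diagonal fun e => ((q ^ (-μ e) : Laurentˣ) : Laurent)
  let φ := (subst (s * q⁻¹) (t * q) 1).toRingHom
  have hP : D.arcMatrix * P = P * φ.mapMatrix D.arcMatrix := by
    refine Matrix.ext ?_
    rintro ⟨c, a⟩ f
    rw [Matrix.mul_diagonal, Matrix.diagonal_mul, RingHom.mapMatrix_apply, Matrix.map_apply]
    change _ = _ * subst (s * q⁻¹) (t * q) 1 _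
    have hdiag : (if (c, a) = f then (1 : Laurent) else 0) * (q ^ (-μ f) : Laurentˣ) =
        (q ^ (-μ (c, a)) : Laurentˣ) * if (c, a) = f then 1 else 0 := by
      split_ifs with hf
      · rw [hf, mul_comm]
      · ring
    have hcoef (b : Side) : coef (D.type c) a b *
        (if D.next.symm (c, b) = f then 1 else 0) * (q ^ (-μ f) : Laurentˣ) =
          (q ^ (-μ (c, a)) : Laurentˣ) * (subst (s * q⁻¹) (t * q) 1 (coef (D.type c) a b) *
            if D.next.symm (c, b) = f then 1 else 0) := by
      split_ifs with hf
      · rw [← hf, hnext, mul_one, mul_one]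
        exact coef_subst _ a b (fun b => μ (c, b)) (hμ c)
      · ring
    rw [arcMatrix_apply]
    simp only [map_sub, map_add, map_mul, apply_ite (subst _ _ _), map_one, map_zero]
    linear_combination hdiag - hcoef .left - hcoef .right
  have hdet := congrArg Matrix.det hP
  rw [Matrix.det_mul, Matrix.det_mul, mul_comm, ← RingHom.map_det] at hdet
  have hP0 : IsUnit P.det := by
    rw [Matrix.det_diagonal, ← Units.coe_prod]
    exact Units.isUnit _
  exact (hP0.mul_left_cancel hdet).symm

end DiagramData

end

end VirtualLink

/-- Every oriented virtual link diagram has a virtual Alexander polynomial, and each choice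
`H` of it satisfies `H(s, t, q) = H(s q⁻¹, t q, 1)` up to units of `ℤ[s^{±1}, t^{±1}, q^{±1}]`. -/
theorem mainTheorem3 (D : VirtualLink.Diagram) :
    (∃ H : VirtualLink.Laurent, D.IsVirtualAlexanderPolynomial H) ∧
    ∀ H : VirtualLink.Laurent, D.IsVirtualAlexanderPolynomial H →
      Associated H
        (VirtualLink.subst (VirtualLink.s * VirtualLink.q⁻¹) (VirtualLink.t * VirtualLink.q) 1 H) := by
  obtain ⟨Δ, hΔ, hinv⟩ : ∃ Δ, D.IsVirtualAlexanderPolynomial Δ ∧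
      VirtualLink.subst (VirtualLink.s * VirtualLink.q⁻¹) (VirtualLink.t * VirtualLink.q) 1 Δ =
        Δ := by
    by_cases h : D.numCircles = 0
    · exact ⟨_, VirtualLink.DiagramData.isLeast_span_det h,
        VirtualLink.DiagramData.subst_det_arcMatrix D.planar⟩
    · refine ⟨0, ⟨⟨⟨0, rfl⟩, ?_⟩, fun I _ => ?_⟩, map_zero _⟩
      · rw [VirtualLink.DiagramData.elementaryIdeal_eq_bot h]
        exact bot_le
      · simp
  refine ⟨⟨Δ, hΔ⟩, fun H hH => ?_⟩
  have hassoc : Associated H Δ := Ideal.span_singleton_eq_span_singleton.1 (hH.unique hΔ)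
  have := hassoc.map
    (VirtualLink.subst (VirtualLink.s * VirtualLink.q⁻¹) (VirtualLink.t * VirtualLink.q) 1)
  rw [hinv] at this
  exact hassoc.trans this.symm
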